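/- Let $X=Y=[0,1]$ with Lebesgue measure $m$, and let $Z=X\times Y$ with the product measure $\mu=m\times m$. For $\Omega\in\{X,Z\}$ let $\mathcal G(\Omega)$ be the set of invertible measure-preserving transformations of $\Omega$, with the weak topology, i.e. the topology generated by the sets $\{S : \lambda(SA\,\triangle\,TA)<\varepsilon\}$, where $T\in\mathcal G(\Omega)$, $A\subseteq\Omega$ is measurable, $\varepsilon>0$ and $\lambda$ is the measure of $\Omega$. For $T_0\in\mathcal G(X)$ let $\mathcal G_{T_0}\subseteq\mathcal G(Z)$ be the subspace of extensions of $T_0$, i.e. of those $T$ with $\pi\circ T=T_0\circ\pi$ almost everywhere, where $\pi:Z\to X$ is the projection. Let $L^2(Z|X)$ be the set of $f\in L^2(Z)$ (complex-valued) such that $\mathbb E(|f|^2|X)^{1/2}\in L^\infty(X)$, and let transformations act on functions by $Tf=f\circ T$. An extension $T\in\mathcal G_{T_0}$ is called strongly mixing if for all $f,g\in L^2(Z|X)$ $$\lim_{n\to\infty}\bigl\|\mathbb E(T^nf\cdot\overline g\,|X)-T_0^n\,\mathbb E(f|X)\;\mathbb E(\overline g|X)\bigr\|_{L^2(X)}=0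 .$$ Let $\mathcal S_{T_0}\subseteq\mathcal G_{T_0}$ be the set of strongly mixing extensions of $T_0$. **Proposition.** If $T_0\in\mathcal G(X)$ is antiperiodic, i.e. the set of periodic points of $T_0$ has measure zero, then the complement $\mathcal G_{T_0}\setminus\mathcal S_{T_0}$ is dense in $\mathcal G_{T_0}$. -/

import Mathlib

open MeasureTheory Filter Topology
open scoped ENNReal symmDiff unitInterval ComplexConjugate

noncomputable section

namespace MixingExt

/-- Invertible measure-preserving transformations of a measure space `Ω`: measurable bijections
with measurable inverse which preserve the measure. -/
structure Aut (Ω : Type*) [MeasureSpace Ω] where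
  toEquiv : Ω ≃ᵐ Ω
  measurePreserving : MeasurePreserving toEquiv (volume : Measure Ω) volume

instance (Ω : Type*) [MeasureSpace Ω] : CoeFun (Aut Ω) (fun _ => Ω → Ω) := ⟨fun T => T.toEquiv⟩

/-- The set of all `S` with `volume (S A ∆ T A) < ε`. -/
def weakNhd {Ω : Type*} [MeasureSpace Ω] (T : Aut Ω) (A : Set Ω) (ε : ℝ≥0∞) : Set (Aut Ω) :=
  {S | volume ((S '' A) ∆ (T '' A)) < ε}

/-- The weak topology: the sets `{S | volume (S A ∆ T A) < ε}`, for measurable `A` and `ε > 0`, form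
a subbasis. (Two transformations that agree almost everywhere are topologically
indistinguishable, so working with transformations or with their classes modulo null sets makes no
difference for density.) -/
instance weakTopology (Ω : Type*) [MeasureSpace Ω] : TopologicalSpace (Aut Ω) :=
  TopologicalSpace.generateFrom
    {U | ∃ (T : Aut Ω) (A : Set Ω) (ε : ℝ≥0∞), MeasurableSet A ∧ 0 < ε ∧ U = weakNhd T A ε}

/-- `T` is antiperiodic if its set of periodic points has measure zero. -/
def Antiperiodic {Ω : Type*} [MeasureSpace Ω] (T : Aut Ω) : Prop :=
  volume {x : Ω | ∃ n : ℕ, 0 < n ∧ (T : Ω → Ω)^[n] x = x} = 0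

/-- The unit square `Z = X × Y`, where `X` and `Y` are the unit interval, with Lebesgue measure. -/
abbrev Z : Type := I × I

/-- The σ-algebra on `Z` of the factor `X`, pulled back under the projection onto `X`. -/
abbrev factorX : MeasurableSpace Z := MeasurableSpace.comap Prod.fst inferInstance

/-- The conditional expectation `𝔼(f | X)`, as an `X`-measurable function on `Z`. -/
def condE {E : Type*} [NormedAddCommGroup E] [NormedSpace ℝ E] [CompleteSpace E]
    (f : Z → E) : Z → E :=
  (volume : Measure Z)[f | factorX]

/-- The space of extensions of `T₀` through the projection onto `X`: those `T` on `Z` with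
`π ∘ T = T₀ ∘ π` almost everywhere. As a subtype it carries the weak topology. -/
abbrev Extension (T₀ : Aut I) : Type :=
  {T : Aut Z // ∀ᵐ z : Z, (T z).1 = T₀ z.1}

/-- The conditional space `L²(Z|X)`: all `f ∈ L²(Z)` for which the function `𝔼(|f|² | X)^(1/2)` is
essentially bounded. -/
def MemL2Cond (f : Z → ℂ) : Prop :=
  MemLp f 2 (volume : Measure Z) ∧
    MemLp (fun z => Real.sqrt (condE (fun w => ‖f w‖ ^ 2) z)) ∞ (volume : Measure Z)

/-- `T` is a strongly mixing extension of `T₀`: for all `f, g ∈ L²(Z|X)`,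
`‖𝔼(Tⁿf · conj g | X) - T₀ⁿ𝔼(f|X) · 𝔼(conj g|X)‖₂ → 0`, where `T` acts by `Tf = f ∘ T` and `T₀` acts
on `X`-measurable functions on `Z` through `T₀ × id`. -/
def IsStronglyMixingExtension (T₀ : Aut I) (T : Extension T₀) : Prop :=
  ∀ f g : Z → ℂ, MemL2Cond f → MemL2Cond g →
    Tendsto (fun n : ℕ =>
      eLpNorm (fun z : Z =>
        condE (fun w => f ((T.1 : Z → Z)^[n] w) * conj (g w)) z
          - condE f ((T₀ : I → I)^[n] z.1, z.2) * condE (fun w => conj (g w)) z)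
        2 (volume : Measure Z)) atTop (𝓝 0)

/-- The set of strongly mixing extensions of `T₀`. -/
def stronglyMixingExtensions (T₀ : Aut I) : Set (Extension T₀) :=
  {T | IsStronglyMixingExtension T₀ T}

end MixingExt

end

/-! Write `R = T₀ × id`. Every extension `T` is approximated by fibrewise conjugates of `R`, and
these are never mixing: if `Φ` preserves measure and each fibre, then `Φ R Φ⁻¹` leaves invariant the
image under `Φ` of `X × [0, 1/2]`, a set of conditional measure 1/2 over `X`.

Antiperiodicity gives a set `B` of measure at most `1/(N+1)` which every backward orbit of `T₀`
meets (`exists_marker`). Let `τ(x)` be the least `n ≥ 0` with `T₀⁻ⁿ x ∈ B`, and put `Φ = T^τ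
R^(-τ)`. If `T₀ x ∉ B` then `τ(T₀ x) = τ(x) + 1`, so `Φ R = T Φ` over `x` (`exists_conj_prodId`).
Hence `Φ R Φ⁻¹` equals `T` almost everywhere off the preimage of `T₀⁻¹ B`, which is as small as
desired. -/

namespace MixingExt

/-! ### Gluing, and convergence in the weak topology -/

section General

variable {Ω : Type*} [MeasureSpace Ω]

/-- The group of invertible measure-preserving transformations, as a subgroup of the group of
permutations. -/
def measAut (Ω : Type*) [MeasureSpace Ω] : Subgroup (Equiv.Perm Ω) where
  carrier := {e | MeasurePreserving e (volume : Measure Ω) volume ∧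
    MeasurePreserving (e⁻¹ : Equiv.Perm Ω) (volume : Measure Ω) volume}
  mul_mem' := by
    rintro a b ⟨ha, ha'⟩ ⟨hb, hb'⟩
    refine ⟨ha.comp hb, ?_⟩
    rw [mul_inv_rev]
    exact hb'.comp ha'
  one_mem' := ⟨MeasurePreserving.id _, MeasurePreserving.id _⟩
  inv_mem' := by
    rintro a ⟨ha, ha'⟩
    exact ⟨ha', by rwa [inv_inv]⟩

/-- The permutation underlying an invertible measure-preserving transformation. -/
def Aut.toPerm (T : Aut Ω) : Equiv.Perm Ω := T.toEquiv.toEquiv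

theorem Aut.toPerm_apply (T : Aut Ω) (z : Ω) : T.toPerm z = T z := rfl

theorem Aut.toPerm_mem (T : Aut Ω) : T.toPerm ∈ measAut Ω :=
  ⟨T.measurePreserving, T.measurePreserving.symm⟩

/-- The invertible measure-preserving transformation given by a member of `measAut`. -/
def autOfMem (e : Equiv.Perm Ω) (he : e ∈ measAut Ω) : Aut Ω where
  toEquiv := ⟨e, he.1.measurable, he.2.measurable⟩
  measurePreserving := he.1

theorem autOfMem_apply (e : Equiv.Perm Ω) (he : e ∈ measAut Ω) (z : Ω) :
    autOfMem e he z = e z := rfl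

theorem measurePreserving_glue {e : ℕ → Equiv.Perm Ω} (he : ∀ n, e n ∈ measAut Ω) {c : Ω → ℕ}
    (hc : Measurable c) (hce : ∀ n z, c (e n z) = c z) :
    MeasurePreserving (fun z => e (c z) z) (volume : Measure Ω) volume := by
  have hm : Measurable fun z => e (c z) z :=
    measurable_from_prod_countable_right (f := fun p : ℕ × Ω => e p.1 p.2)
      (fun n => (he n).1.measurable) |>.comp (hc.prodMk measurable_id)
  refine ⟨hm, Measure.ext fun A hA => ?_⟩
  have hcn : ∀ n, MeasurableSet (c ⁻¹' {n}) := fun n => hc (measurableSet_singleton n)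
  have hsplit : ∀ B : Set Ω, MeasurableSet B → volume B = ∑' n, volume (B ∩ c ⁻¹' {n}) := by
    intro B hB
    rw [← measure_iUnion _ fun n => hB.inter (hcn n)]
    · congr 1
      ext z
      simp
    · intro m n hmn
      refine Set.disjoint_left.2 fun z hz hz' => hmn ?_
      rw [← hz.2, ← hz'.2]
  rw [Measure.map_apply hm hA, hsplit _ (hm hA), hsplit _ hA]
  refine tsum_congr fun n => ?_
  rw [← (he n).1.measure_preimage (hA.inter (hcn n)).nullMeasurableSet]
  congr 1
  ext z
  simp only [Set.mem_inter_iff, Set.mem_preimage, Set.mem_singleton_iff, hce]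
  constructor <;> rintro ⟨h, rfl⟩ <;> exact ⟨h, rfl⟩

/-- The transformations `e n`, each of which preserves the colouring `c`, can be glued: `e n` is
applied to the points of colour `n`. -/
theorem exists_glue {e : ℕ → Equiv.Perm Ω} (he : ∀ n, e n ∈ measAut Ω) {c : Ω → ℕ}
    (hc : Measurable c) (hce : ∀ n z, c (e n z) = c z) :
    ∃ g ∈ measAut Ω, ∀ z, g z = e (c z) z := by
  have hce' : ∀ n z, c ((e n)⁻¹ z) = c z := fun n z => by
    rw [← hce n]
    exact congrArg c (Equiv.apply_symm_apply (e n) z)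
  refine ⟨⟨fun z => e (c z) z, fun z => (e (c z))⁻¹ z, fun z => ?_, fun z => ?_⟩, ⟨?_, ?_⟩,
    fun z => rfl⟩
  · simp only [hce]
    exact Equiv.symm_apply_apply _ z
  · simp only [hce']
    exact Equiv.apply_symm_apply _ z
  · exact measurePreserving_glue he hc hce
  · exact measurePreserving_glue (fun n => (measAut Ω).inv_mem (he n)) hc hce'

/-- Outside the images of the set `D` where `S` and `T` differ, `SA` and `TA` coincide, so `SA ∆ TA`
has measure at most twice that of `D`. -/
theorem tendsto_of_tendsto_volume_ne {ι : Type*} {l : Filter ι} {S : ι → Aut Ω} {T : Aut Ω}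
    (h : Tendsto (fun i => volume {z | S i z ≠ T z}) l (𝓝 0)) : Tendsto S l (𝓝 T) := by
  rw [TopologicalSpace.tendsto_nhds_generateFrom_iff]
  rintro _ ⟨T', A, ε, -, -, rfl⟩ hT
  have himage : ∀ (R : Aut Ω) (D : Set Ω), volume (R '' D) = volume D := fun R D => by
    rw [← R.measurePreserving.measure_preimage_equiv]
    congr 1
    exact Set.preimage_image_eq _ R.toEquiv.injective
  have hlim : Tendsto (fun i => volume {z | S i z ≠ T z} + volume {z | S i z ≠ T z} +
      volume ((T '' A) ∆ (T' '' A))) l (𝓝 (volume ((T '' A) ∆ (T' '' A)))) := by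
    simpa using (h.add h).add_const (volume ((T '' A) ∆ (T' '' A)))
  filter_upwards [hlim.eventually_lt_const hT] with i hi
  refine lt_of_le_of_lt ?_ hi
  refine (measure_symmDiff_le _ (T '' A) _).trans ?_
  gcongr
  refine (measure_mono (t := (S i '' {z | S i z ≠ T z}) ∪ (T '' {z | S i z ≠ T z})) ?_).trans
    ((measure_union_le _ _).trans_eq (by rw [himage, himage]))
  rintro _ (⟨⟨z, hz, rfl⟩, h2⟩ | ⟨⟨z, hz, rfl⟩, h2⟩)
  · exact Or.inl ⟨z, fun h => h2 ⟨z, hz, h.symm⟩, rfl⟩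
  · exact Or.inr ⟨z, fun h => h2 ⟨z, hz, h⟩, rfl⟩

theorem zpow_measurable {T : Equiv.Perm Ω} (hT : T ∈ measAut Ω) (i : ℤ) :
    Measurable (T ^ i : Equiv.Perm Ω) :=
  ((measAut Ω).zpow_mem hT i).1.measurable

end General

/-! ### Small markers for antiperiodic transformations -/

section Marker

variable {Ω : Type*}

/-- The greedy construction of a set whose first `N` translates are disjoint. -/
def greedy (T : Equiv.Perm Ω) (C : ℕ → Set Ω) (N : ℕ) : ℕ → Set Ω
  | 0 => ∅
  | k + 1 => greedy T C N k ∪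
      (C k \ ⋃ i ∈ Finset.Icc (-N : ℤ) N, (T ^ i : Equiv.Perm Ω) ⁻¹' greedy T C N k)

theorem greedy_mono (T : Equiv.Perm Ω) (C : ℕ → Set Ω) (N : ℕ) : Monotone (greedy T C N) :=
  monotone_nat_of_le_succ fun _ => Set.subset_union_left

theorem measurableSet_greedy [MeasureSpace Ω] {T : Equiv.Perm Ω} (hT : T ∈ measAut Ω) {C : ℕ → Set Ω}
    (hC : ∀ k, MeasurableSet (C k)) (N k : ℕ) : MeasurableSet (greedy T C N k) := by
  induction k with
  | zero => exact MeasurableSet.empty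
  | succ k ih =>
    exact ih.union ((hC k).diff (Finset.measurableSet_biUnion _ fun i _ =>
      zpow_measurable hT i ih))

theorem exists_stage_of_mem_greedy {T : Equiv.Perm Ω} {C : ℕ → Set Ω} {N k : ℕ} {x : Ω}
    (h : x ∈ greedy T C N k) : ∃ j, x ∈ greedy T C N (j + 1) ∧ x ∈ C j ∧
      ∀ i ∈ Finset.Icc (-N : ℤ) N, (T ^ i : Equiv.Perm Ω) x ∉ greedy T C N j := by
  induction k with
  | zero => exact h.elim
  | succ k ih =>
    rcases h with h | h
    · exact ih h
    · refine ⟨k, Or.inr h, h.1, fun i hi hx => h.2 ?_⟩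
      simp only [Set.mem_iUnion]
      exact ⟨i, hi, hx⟩

/-- Of two points added at different stages, the later one was barred by the earlier, whichever
comes first on the orbit, because the excluded window is two-sided. Points added at the same stage
are separated by the hypothesis on `C`. -/
theorem greedy_disjoint {T : Equiv.Perm Ω} {C : ℕ → Set Ω} {N : ℕ}
    (hC : ∀ k, ∀ x ∈ C k, ∀ i : ℕ, 1 ≤ i → i ≤ N → (T ^ i) x ∉ C k) {x : Ω} {i : ℕ} (h1 : 1 ≤ i)
    (hN : i ≤ N) (hx : x ∈ ⋃ k, greedy T C N k) : (T ^ i) x ∉ ⋃ k, greedy T C N k := by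
  intro hy
  obtain ⟨k, hx⟩ := Set.mem_iUnion.1 hx
  obtain ⟨l, hy⟩ := Set.mem_iUnion.1 hy
  obtain ⟨k, hxk, hxC, hxn⟩ := exists_stage_of_mem_greedy hx
  obtain ⟨l, hyl, hyC, hyn⟩ := exists_stage_of_mem_greedy hy
  rcases lt_trichotomy k l with hkl | rfl | hkl
  · refine hyn (-i : ℤ) (by simp; omega) (greedy_mono T C N (Nat.succ_le_of_lt hkl) ?_)
    simpa using hxk
  · exact hC k x hxC i h1 hN hyC
  · refine hxn (i : ℤ) (by simp; omega) (greedy_mono T C N (Nat.succ_le_of_lt hkl) ?_)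
    simpa using hyl

/-- Maximality: a point of `C k` is either added at its stage or rejected because the set already
meets its window. -/
theorem exists_zpow_mem_greedy {T : Equiv.Perm Ω} {C : ℕ → Set Ω} (N : ℕ) {x : Ω}
    (hx : x ∈ ⋃ k, C k) : ∃ i ∈ Finset.Icc (-N : ℤ) N,
      (T ^ i : Equiv.Perm Ω) x ∈ ⋃ k, greedy T C N k := by
  obtain ⟨k, hk⟩ := Set.mem_iUnion.1 hx
  by_cases h : x ∈ ⋃ i ∈ Finset.Icc (-N : ℤ) N, (T ^ i : Equiv.Perm Ω) ⁻¹' greedy T C N k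
  · simp only [Set.mem_iUnion] at h
    obtain ⟨i, hi, h⟩ := h
    exact ⟨i, hi, Set.mem_iUnion.2 ⟨k, h⟩⟩
  · exact ⟨0, by simp, Set.mem_iUnion.2 ⟨k + 1, Or.inr ⟨hk, h⟩⟩⟩

theorem volume_le_of_disjoint_translates [MeasureSpace Ω] [IsProbabilityMeasure (volume : Measure Ω)]
    {T : Equiv.Perm Ω} (hT : T ∈ measAut Ω) {N : ℕ} {B : Set Ω} (hB : MeasurableSet B)
    (hd : ∀ x ∈ B, ∀ i : ℕ, 1 ≤ i → i ≤ N → (T ^ i) x ∉ B) :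
    volume B ≤ ((N : ℝ≥0∞) + 1)⁻¹ := by
  have hpow : ∀ i : ℕ, T ^ i ∈ measAut Ω := fun i => (measAut Ω).pow_mem hT i
  have hdisj : Set.PairwiseDisjoint (Finset.range (N + 1) : Set ℕ) fun i => (T ^ i) ⁻¹' B := by
    have key : ∀ i j : ℕ, i < j → j ≤ N → Disjoint ((T ^ i) ⁻¹' B) ((T ^ j) ⁻¹' B) := by
      intro i j hij hj
      refine Set.disjoint_left.2 fun z hz hz' => hd _ hz (j - i) (by omega) (by omega) ?_
      rw [← Equiv.Perm.mul_apply, ← pow_add, Nat.sub_add_cancel hij.le]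
      exact hz'
    intro i hi j hj hij
    simp only [Finset.coe_range, Set.mem_Iio] at hi hj
    rcases lt_or_gt_of_ne hij with h | h
    · exact key i j h (by omega)
    · exact (key j i h (by omega)).symm
  have hsum : ((N : ℝ≥0∞) + 1) * volume B ≤ 1 := by
    calc ((N : ℝ≥0∞) + 1) * volume B
        = ∑ i ∈ Finset.range (N + 1), volume ((T ^ i) ⁻¹' B) := by
          rw [Finset.sum_congr rfl fun i _ => (hpow i).1.measure_preimage hB.nullMeasurableSet]
          simp
      _ = volume (⋃ i ∈ Finset.range (N + 1), (T ^ i) ⁻¹' B) :=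
          (measure_biUnion_finset hdisj fun i _ => (hpow i).1.measurable hB).symm
      _ ≤ 1 := prob_le_one
  rw [ENNReal.le_inv_iff_mul_le, mul_comm]
  exact hsum

/-- Marker lemma: an antiperiodic transformation has arbitrarily small sets which every orbit
meets in the past. -/
theorem exists_marker [MeasureSpace Ω] [TopologicalSpace Ω] [SecondCountableTopology Ω]
    [T2Space Ω] [BorelSpace Ω] [IsProbabilityMeasure (volume : Measure Ω)] {T : Equiv.Perm Ω} (hT : T ∈ measAut Ω)
    (hap : volume {x : Ω | ∃ n : ℕ, 0 < n ∧ (T ^ n) x = x} = 0) (N : ℕ) :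
    ∃ B : Set Ω, MeasurableSet B ∧ volume B ≤ ((N : ℝ≥0∞) + 1)⁻¹ ∧
      ∀ x, ∃ n : ℕ, ((T ^ n)⁻¹ : Equiv.Perm Ω) x ∈ B := by
  have hpow : ∀ i : ℕ, Measurable (T ^ i : Equiv.Perm Ω) := fun i =>
    ((measAut Ω).pow_mem hT i).1.measurable
  set P : Set Ω := {x : Ω | ∃ n : ℕ, 0 < n ∧ (T ^ n) x = x} with hP
  have hPm : MeasurableSet P := by
    have : P = ⋃ n : ℕ, ⋃ _ : 0 < n, {x | (T ^ n) x = x} := by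
      ext x
      simp [hP]
    rw [this]
    exact MeasurableSet.iUnion fun n => MeasurableSet.iUnion fun _ =>
      measurableSet_eq_fun (hpow n) measurable_id
  have : Nonempty Ω := nonempty_of_isProbabilityMeasure volume
  obtain ⟨U, hU⟩ := (TopologicalSpace.countable_countableBasis Ω).exists_eq_range
    (by
      obtain ⟨v, hv, -⟩ := (TopologicalSpace.isBasis_countableBasis Ω).mem_nhds_iff.1
        (univ_mem : Set.univ ∈ 𝓝 (Classical.arbitrary Ω))
      exact ⟨v, hv⟩)
  have hUb : TopologicalSpace.IsTopologicalBasis (Set.range U) :=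
    hU ▸ TopologicalSpace.isBasis_countableBasis Ω
  have hUo : ∀ k, IsOpen (U k) := fun k => hUb.isOpen ⟨k, rfl⟩
  set C : ℕ → Set Ω := fun k => U k \ ⋃ i ∈ Finset.Icc 1 N, (T ^ i) ⁻¹' U k with hCdef
  have hCm : ∀ k, MeasurableSet (C k) := fun k =>
    (hUo k).measurableSet.diff (Finset.measurableSet_biUnion _ fun i _ =>
      hpow i (hUo k).measurableSet)
  have hCd : ∀ k, ∀ x ∈ C k, ∀ i : ℕ, 1 ≤ i → i ≤ N → (T ^ i) x ∉ C k := by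
    intro k x hx i h1 h2 h
    refine hx.2 ?_
    simp only [Set.mem_iUnion]
    exact ⟨i, Finset.mem_Icc.2 ⟨h1, h2⟩, h.1⟩
  -- A nonperiodic `x` has a basic neighbourhood missing the finitely many points `T x, …, T^N x`.
  have hcover : ∀ x, x ∉ P → x ∈ ⋃ k, C k := by
    intro x hx
    have hfin : ((fun i => (T ^ i) x) '' (Finset.Icc 1 N : Finset ℕ))ᶜ ∈ 𝓝 x := by
      refine ((Finset.finite_toSet _).image _).isClosed.isOpen_compl.mem_nhds fun h => hx ?_
      obtain ⟨i, hi, hix⟩ := h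
      exact ⟨i, (Finset.mem_Icc.1 (Finset.mem_coe.1 hi)).1, hix⟩
    obtain ⟨_, ⟨k, rfl⟩, hxk, hk⟩ := hUb.mem_nhds_iff.1 hfin
    refine Set.mem_iUnion.2 ⟨k, hxk, fun h => ?_⟩
    simp only [Set.mem_iUnion] at h
    obtain ⟨i, hi, h⟩ := h
    exact hk h ⟨i, hi, rfl⟩
  set G : Set Ω := ⋃ k, greedy T C N k
  have hGm : MeasurableSet G := MeasurableSet.iUnion fun k => measurableSet_greedy hT hCm N k
  -- Orbits meet `G` at some time in `[-N, N]`; shifting by `N` makes that time nonpositive. The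
  -- null set `P` takes care of periodic points.
  refine ⟨(T ^ N) ⁻¹' G ∪ P, (hpow N hGm).union hPm, ?_, fun x => ?_⟩
  · refine (measure_union_le _ _).trans ?_
    rw [hap, add_zero, ((measAut Ω).pow_mem hT N).1.measure_preimage hGm.nullMeasurableSet]
    exact volume_le_of_disjoint_translates hT hGm fun x hx i h1 h2 => greedy_disjoint hCd h1 h2 hx
  · by_cases hx : x ∈ P
    · exact ⟨0, Or.inr (by simpa using hx)⟩
    · obtain ⟨i, hi, h⟩ := exists_zpow_mem_greedy N (T := T) (hcover x hx)
      rw [Finset.mem_Icc] at hi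
      refine ⟨(N - i).toNat, Or.inl ?_⟩
      have : T ^ N * (T ^ (N - i).toNat)⁻¹ = T ^ i := by
        rw [← zpow_natCast, ← zpow_natCast, ← zpow_neg, ← zpow_add, Int.toNat_of_nonneg (by omega)]
        congr 1
        omega
      rwa [Set.mem_preimage, ← Equiv.Perm.mul_apply, this]

end Marker

/-! ### Conjugates of the product extension -/

section Extensions

/-- The product `T₀ × id` on the square. -/
noncomputable def prodId (T₀ : Aut I) : Equiv.Perm Z := Equiv.prodCongr T₀.toPerm (Equiv.refl I)

theorem prodId_apply (T₀ : Aut I) (z : Z) : prodId T₀ z = (T₀ z.1, z.2) := rfl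

theorem prodId_mem (T₀ : Aut I) : prodId T₀ ∈ measAut Z :=
  ⟨T₀.toPerm_mem.1.prod (MeasurePreserving.id volume),
    T₀.toPerm_mem.2.prod (MeasurePreserving.id volume)⟩

theorem pow_apply_fst {T₀ : Aut I} {T : Equiv.Perm Z} (h : ∀ z, (T z).1 = T₀ z.1) (n : ℕ) (z : Z) :
    ((T ^ n) z).1 = (T₀.toPerm ^ n) z.1 := by
  induction n with
  | zero => rfl
  | succ n ih =>
    rw [pow_succ', pow_succ', Equiv.Perm.mul_apply, Equiv.Perm.mul_apply, h, ih, Aut.toPerm_apply]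

/-- An extension agrees almost everywhere with one that commutes with the projection everywhere. -/
theorem exists_exact_extension {T₀ : Aut I} (T : Extension T₀) :
    ∃ T' ∈ measAut Z, (∀ z, (T' z).1 = T₀ z.1) ∧ ∀ᵐ z : Z, T' z = T.1 z := by
  classical
  set R := prodId T₀
  set K : Subgroup (Equiv.Perm Z) := Subgroup.closure {T.1.toPerm, R} with hK
  have hTK : T.1.toPerm ∈ K := Subgroup.subset_closure (by simp)
  have hRK : R ∈ K := Subgroup.subset_closure (by simp)
  have hKle : K ≤ measAut Z := by
    rw [hK, Subgroup.closure_le]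
    rintro e (rfl | rfl)
    · exact T.1.toPerm_mem
    · exact prodId_mem T₀
  have : Countable K := by
    have : Countable (FreeGroup ({T.1.toPerm, R} : Set (Equiv.Perm Z))) :=
      Quot.mk_surjective.countable
    rw [hK, FreeGroup.closure_eq_range]
    exact Set.countable_range _
  set N₀ : Set Z := {z | (T.1 z).1 ≠ T₀ z.1} with hN₀
  have hN₀m : MeasurableSet N₀ :=
    (measurableSet_eq_fun (measurable_fst.comp T.1.measurePreserving.measurable)
      (T₀.measurePreserving.measurable.comp measurable_fst)).compl
  have hN₀0 : volume N₀ = 0 := ae_iff.1 T.2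
  -- Saturating under the countable group `K` keeps the bad set null and makes it invariant under
  -- both `T` and `R`, so `R` can replace `T` on it.
  set N : Set Z := ⋃ g : K, (g : Equiv.Perm Z) ⁻¹' N₀ with hN
  have hNm : MeasurableSet N := MeasurableSet.iUnion fun g => (hKle g.2).1.measurable hN₀m
  have hN0 : volume N = 0 := measure_iUnion_null fun g => by
    rw [(hKle g.2).1.measure_preimage hN₀m.nullMeasurableSet, hN₀0]
  have hinv : ∀ e ∈ K, ∀ z, e z ∈ N ↔ z ∈ N := by
    intro e he z
    simp only [hN, Set.mem_iUnion, Set.mem_preimage]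
    constructor
    · rintro ⟨g, hg⟩
      exact ⟨g * (⟨e, he⟩ : K), hg⟩
    · rintro ⟨g, hg⟩
      refine ⟨g * (⟨e, he⟩ : K)⁻¹, ?_⟩
      rwa [← Equiv.Perm.mul_apply, Subgroup.coe_mul, Subgroup.coe_inv, inv_mul_cancel_right]
  obtain ⟨T', hT', hT'z⟩ := exists_glue (Ω := Z) (e := fun n => if n = 0 then T.1.toPerm else R)
    (c := fun z => if z ∈ N then 1 else 0) (fun n => by
      split_ifs
      · exact T.1.toPerm_mem
      · exact prodId_mem T₀)
    (Measurable.ite hNm measurable_const measurable_const) (fun n z => by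
      congr 1
      split_ifs
      · exact propext (hinv _ hTK z)
      · exact propext (hinv _ hRK z))
  refine ⟨T', hT', fun z => ?_, ?_⟩
  · rw [hT'z]
    by_cases hz : z ∈ N
    · simp [hz, R, prodId_apply]
    · by_contra hne
      refine hz (Set.mem_iUnion.2 ⟨1, ?_⟩)
      rw [if_neg hz] at hne
      exact hne
  · have : ∀ᵐ z : Z, z ∉ N := measure_eq_zero_iff_ae_notMem.1 hN0
    filter_upwards [this] with z hz
    rw [hT'z]
    simp [hz, Aut.toPerm_apply]

/-- An exact extension is, off the set of points which enter a marker `B` of `T₀`, conjugate to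
`T₀ × id` by a transformation which preserves every fibre. -/
theorem exists_conj_prodId {T₀ : Aut I} {T : Equiv.Perm Z} (hT : T ∈ measAut Z)
    (hTz : ∀ z, (T z).1 = T₀ z.1) {B : Set I} (hB : MeasurableSet B)
    (hhit : ∀ x, ∃ n : ℕ, ((T₀.toPerm ^ n)⁻¹ : Equiv.Perm I) x ∈ B) :
    ∃ Φ ∈ measAut Z, (∀ z, (Φ z).1 = z.1) ∧
      ∀ z, T₀ z.1 ∉ B → Φ (prodId T₀ z) = T (Φ z) := by
  classical
  set R := prodId T₀
  have hR : R ∈ measAut Z := prodId_mem T₀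
  have hfst : ∀ (n : ℕ) (z : Z), ((T ^ n * (R ^ n)⁻¹) z).1 = z.1 := by
    intro n z
    obtain ⟨w, rfl⟩ := (R ^ n).surjective z
    rw [← Equiv.Perm.mul_apply, inv_mul_cancel_right, pow_apply_fst hTz,
      pow_apply_fst (T := R) fun z => rfl]
  have hτm : Measurable fun x => Nat.find (hhit x) :=
    measurable_find hhit fun n => ((measAut I).inv_mem
      ((measAut I).pow_mem T₀.toPerm_mem n)).1.measurable hB
  obtain ⟨Φ, hΦ, hΦz⟩ := exists_glue (Ω := Z) (e := fun n => T ^ n * (R ^ n)⁻¹)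
    (c := fun z => Nat.find (hhit z.1))
    (fun n => (measAut Z).mul_mem ((measAut Z).pow_mem hT n)
      ((measAut Z).inv_mem ((measAut Z).pow_mem hR n)))
    (hτm.comp measurable_fst) (fun n z => by simp only [hfst])
  refine ⟨Φ, hΦ, fun z => by rw [hΦz, hfst], fun z hz => ?_⟩
  have hstep : ∀ n : ℕ, ((T₀.toPerm ^ (n + 1))⁻¹ : Equiv.Perm I) (T₀ z.1) =
      ((T₀.toPerm ^ n)⁻¹ : Equiv.Perm I) z.1 := by
    intro n
    rw [← T₀.toPerm_apply, ← Equiv.Perm.mul_apply, pow_succ', mul_inv_rev, inv_mul_cancel_right]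
  have hτ : Nat.find (hhit (R z).1) = Nat.find (hhit z.1) + 1 := by
    rw [Nat.find_eq_iff]
    refine ⟨?_, fun n hn => ?_⟩
    · have := Nat.find_spec (hhit z.1)
      rw [← hstep] at this
      exact this
    · cases n with
      | zero => exact hz
      | succ n =>
        have := Nat.find_min (hhit z.1) (Nat.lt_of_succ_lt_succ hn)
        rw [← hstep] at this
        exact this
  rw [hΦz, hΦz, hτ, ← Equiv.Perm.mul_apply, ← Equiv.Perm.mul_apply]
  congr 1
  rw [pow_succ' T, pow_succ' R, mul_inv_rev]
  simp only [mul_assoc, inv_mul_cancel, mul_one]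

/-! ### Failure of mixing -/

theorem condE_indicator_ae_eq {E : Type*} [NormedAddCommGroup E] [NormedSpace ℝ E]
    [CompleteSpace E] {A : Set Z} (hA : MeasurableSet A) {α : ℝ≥0∞}
    (hAα : ∀ C : Set I, MeasurableSet C → volume (A ∩ Prod.fst ⁻¹' C) = α * volume C) (c : E) :
    condE (A.indicator fun _ => c) =ᵐ[volume] fun _ => α.toReal • c := by
  have hle : factorX ≤ (inferInstance : MeasurableSpace Z) := measurable_fst.comap_le
  refine (ae_eq_condExp_of_forall_setIntegral_eq hle ((integrable_const c).indicator hA)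
    (fun s _ _ => (integrable_const _).integrableOn) ?_
    stronglyMeasurable_const.aestronglyMeasurable).symm
  rintro _ ⟨C, hC, rfl⟩ -
  have hCv : volume (Prod.fst ⁻¹' C : Set Z) = volume C :=
    measurePreserving_fst.measure_preimage hC.nullMeasurableSet
  rw [setIntegral_const, setIntegral_indicator hA, setIntegral_const, Set.inter_comm, smul_smul]
  congr 1
  simp only [Measure.real, hAα C hC, hCv, ENNReal.toReal_mul, mul_comm]

/-- An extension with a nontrivial invariant set that is independent of the factor is not strongly
mixing. -/
theorem not_isStronglyMixingExtension {T₀ : Aut I} {S : Extension T₀} {A : Set Z}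
    (hA : MeasurableSet A) (hinv : ∀ z, S.1 z ∈ A ↔ z ∈ A) {α : ℝ≥0∞} (hα0 : α ≠ 0) (hα1 : α < 1)
    (hAα : ∀ C : Set I, MeasurableSet C → volume (A ∩ Prod.fst ⁻¹' C) = α * volume C) :
    ¬ IsStronglyMixingExtension T₀ S := by
  intro h
  set f : Z → ℂ := A.indicator fun _ => 1 with hf
  have hcond : condE f =ᵐ[volume] fun _ => (α.toReal : ℂ) := by
    simpa using condE_indicator_ae_eq hA hAα (1 : ℂ)
  have hmem : MemL2Cond f := by
    refine ⟨memLp_indicator_const 2 hA 1 (Or.inr (measure_ne_top _ _)), ?_⟩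
    have hsq : (fun w => ‖f w‖ ^ 2) = A.indicator fun _ => (1 : ℝ) := by
      ext w
      by_cases hw : w ∈ A <;> simp [hf, hw]
    have hae : (fun _ : Z => Real.sqrt α.toReal) =ᵐ[volume]
        fun z => Real.sqrt (condE (fun w => ‖f w‖ ^ 2) z) := by
      rw [hsq]
      filter_upwards [condE_indicator_ae_eq hA hAα (1 : ℝ)] with z hz
      rw [hz, smul_eq_mul, mul_one]
    exact (memLp_const _).ae_eq hae
  have hiter : ∀ (n : ℕ) (w : Z), f ((S.1 : Z → Z)^[n] w) = f w := by
    intro n w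
    have : (S.1 : Z → Z)^[n] w ∈ A ↔ w ∈ A := by
      induction n with
      | zero => rfl
      | succ n ih => rw [Function.iterate_succ_apply', hinv, ih]
    by_cases hw : w ∈ A <;> simp [hf, hw, this]
  have hconj : (fun w => conj (f w)) = f := by
    ext w
    by_cases hw : w ∈ A <;> simp [hf, hw]
  have hsq : ∀ n : ℕ, (fun w => f ((S.1 : Z → Z)^[n] w) * conj (f w)) = f := by
    intro n
    ext w
    rw [hiter]
    by_cases hw : w ∈ A <;> simp [hf, hw]
  have hpres : ∀ n : ℕ, MeasurePreserving
      (fun z : Z => ((T₀ : I → I)^[n] z.1, z.2)) volume volume := fun n =>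
    (T₀.measurePreserving.iterate n).prod (MeasurePreserving.id volume)
  -- Invariance makes the mixing defect of `f` against itself the constant `α - α²`, nonzero for `0
  -- < α < 1`.
  have hconst : ∀ n : ℕ, eLpNorm (fun z : Z =>
      condE (fun w => f ((S.1 : Z → Z)^[n] w) * conj (f w)) z
        - condE f ((T₀ : I → I)^[n] z.1, z.2) * condE (fun w => conj (f w)) z) 2
        (volume : Measure Z) = ‖(α.toReal : ℂ) - α.toReal * α.toReal‖ₑ := by
    intro n
    rw [hsq, hconj]
    have hae : (fun z : Z => condE f z - condE f ((T₀ : I → I)^[n] z.1, z.2) * condE f z)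
        =ᵐ[volume] fun _ => (α.toReal : ℂ) - α.toReal * α.toReal := by
      filter_upwards [hcond, (hpres n).quasiMeasurePreserving.ae hcond] with z h1 h2
      rw [h1, h2]
    rw [eLpNorm_congr_ae hae, eLpNorm_const _ (by norm_num) (NeZero.ne _)]
    simp
  have hlim := h f f hmem hmem
  simp only [hconst] at hlim
  have hzero := tendsto_nhds_unique hlim tendsto_const_nhds
  have h0 : α.toReal ≠ 0 := (ENNReal.toReal_pos hα0 hα1.ne_top).ne'
  have h1 : α.toReal ≠ 1 := by
    rw [← ENNReal.toReal_one]
    exact ((ENNReal.toReal_lt_toReal hα1.ne_top ENNReal.one_ne_top).2 hα1).ne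
  rw [eq_comm, enorm_eq_zero, ← mul_one_sub, mul_eq_zero] at hzero
  norm_cast at hzero
  rcases hzero with hz | hz
  · exact h0 hz
  · exact h1 (by linarith)

/-- Extensions conjugate to `T₀ × id` by a fibre-preserving transformation are not strongly
mixing. -/
theorem not_isStronglyMixingExtension_of_conj {T₀ : Aut I} {S : Extension T₀} {Φ : Equiv.Perm Z}
    (hΦ : Φ ∈ measAut Z) (hΦz : ∀ z, (Φ z).1 = z.1) (hS : ∀ z, S.1 (Φ z) = Φ (prodId T₀ z)) :
    ¬ IsStronglyMixingExtension T₀ S := by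
  -- Any height strictly between 0 and 1 would serve.
  set h : I := ⟨1 / 2, by norm_num, by norm_num⟩
  set α : ℝ≥0∞ := volume (Set.Iic h) with hα
  have hα' : α = ENNReal.ofReal (1 / 2) := unitInterval.volume_Iic h
  refine not_isStronglyMixingExtension (A := (Φ⁻¹ : Equiv.Perm Z) ⁻¹' (Prod.snd ⁻¹' Set.Iic h))
    (α := α) (hΦ.2.measurable (measurable_snd measurableSet_Iic)) (fun z => ?_) ?_ ?_
    fun C hC => ?_
  · obtain ⟨w, rfl⟩ := Φ.surjective z
    rw [hS]
    simp only [Set.mem_preimage, Equiv.Perm.inv_def, Equiv.symm_apply_apply, prodId_apply]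
  · rw [hα']
    simp
  · rw [hα', ENNReal.ofReal_lt_one]
    norm_num
  · rw [← hΦ.1.measure_preimage ((hΦ.2.measurable (measurable_snd measurableSet_Iic)).inter
      (measurable_fst hC)).nullMeasurableSet]
    have : Φ ⁻¹' ((Φ⁻¹ : Equiv.Perm Z) ⁻¹' (Prod.snd ⁻¹' Set.Iic h) ∩ Prod.fst ⁻¹' C) =
        C ×ˢ Set.Iic h := by
      ext z
      simp [Equiv.Perm.inv_def, hΦz, and_comm]
    rw [this, Measure.volume_eq_prod, Measure.prod_prod, mul_comm]

theorem exists_not_stronglyMixing_near {T₀ : Aut I} (hT₀ : Antiperiodic T₀) (T : Extension T₀)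
    (N : ℕ) : ∃ S : Extension T₀, ¬ IsStronglyMixingExtension T₀ S ∧
      volume {z | S.1 z ≠ T.1 z} ≤ ((N : ℝ≥0∞) + 1)⁻¹ := by
  obtain ⟨T', hT', hT'z, hTT'⟩ := exists_exact_extension T
  have hap : volume {x : I | ∃ n : ℕ, 0 < n ∧ (T₀.toPerm ^ n) x = x} = 0 := by
    simp only [← Equiv.Perm.iterate_eq_pow]
    exact hT₀
  obtain ⟨B, hB, hBN, hhit⟩ := exists_marker T₀.toPerm_mem hap N
  obtain ⟨Φ, hΦ, hΦz, hconj⟩ := exists_conj_prodId hT' hT'z hB hhit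
  have hSmem : Φ * prodId T₀ * Φ⁻¹ ∈ measAut Z :=
    (measAut Z).mul_mem ((measAut Z).mul_mem hΦ (prodId_mem T₀)) ((measAut Z).inv_mem hΦ)
  have hSΦ : ∀ z, autOfMem _ hSmem (Φ z) = Φ (prodId T₀ z) := fun z => by
    rw [autOfMem_apply, ← Equiv.Perm.mul_apply, inv_mul_cancel_right, Equiv.Perm.mul_apply]
  refine ⟨⟨autOfMem _ hSmem, ae_of_all _ fun z => ?_⟩,
    not_isStronglyMixingExtension_of_conj hΦ hΦz hSΦ, ?_⟩
  · obtain ⟨w, rfl⟩ := Φ.surjective z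
    rw [hSΦ, hΦz, hΦz, prodId_apply]
  · refine le_trans ?_ hBN
    have hpre : volume ((fun z : Z => T₀ z.1) ⁻¹' B) = volume B :=
      (T₀.measurePreserving.comp measurePreserving_fst).measure_preimage hB.nullMeasurableSet
    rw [← hpre]
    refine measure_mono_ae ?_
    filter_upwards [hTT'] with z hz hne
    by_contra hzB
    refine hne ?_
    obtain ⟨w, rfl⟩ := Φ.surjective z
    change autOfMem _ hSmem (Φ w) = T.1 (Φ w)
    rw [hSΦ, hconj w, hz]
    intro h
    refine hzB ?_
    change T₀ (Φ w).1 ∈ B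
    rwa [hΦz]

end Extensions

end MixingExt

theorem mainTheorem5 (T₀ : MixingExt.Aut unitInterval) (hT₀ : MixingExt.Antiperiodic T₀) :
    Dense ((MixingExt.stronglyMixingExtensions T₀)ᶜ : Set (MixingExt.Extension T₀)) := by
  intro T
  choose S hS hST using MixingExt.exists_not_stronglyMixing_near hT₀ T
  have hlim : Tendsto (fun N : ℕ => ((N : ℝ≥0∞) + 1)⁻¹) atTop (𝓝 0) := by
    simpa using (tendsto_add_atTop_iff_nat 1).2 ENNReal.tendsto_inv_nat_nhds_zero
  refine mem_closure_of_tendsto (f := S) (b := atTop) ?_ (Eventually.of_forall hS)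
  rw [tendsto_subtype_rng]
  exact MixingExt.tendsto_of_tendsto_volume_ne
    (tendsto_of_tendsto_of_tendsto_of_le_of_le tendsto_const_nhds hlim (fun _ => zero_le) hST)
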